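/- Let $s>2$ be an integer, $A=\{0,1,\dots,s-1\}$ and $A_0=A\setminus\{0\}$. Let $\tilde S\subset[0,1]$ be the set of all numbers $x=\sum_{n\ge 1} d_n s^{-n}$ ($d_n\in A$) whose $s$-adic representation $d_1d_2d_3\dots$ is an infinite concatenation of combinations of digits of the form $\underbrace{u\dots u}_{c-1}c$ with $u\in A$, $c\in A_0$, $c\ne u$ (both $u$ and $c$ may change from one combination to the next). Then $\tilde S$ is a self-similar fractal, and its Hausdorff dimension $\alpha_0$ satisfies $$\left(\frac1s\right)^{\alpha_0}+(s-1)\left(\frac1s\right)^{2\alpha_0}+(s-1)\left(\frac1s\right)^{3\alpha_0}+\dots+(s-1)\left(\frac1s\right)^{(s-1)\alpha_0}=1.$$ Here "self-similar" means that $\tilde S$ is nonempty, compact, and the union of its images under finitely many (at least two) contracting similarities of $\mathbb R$, that its $\alpha_0$-dimensional Hausdorff measure is positive, and that this measure vanishes on the intersection of any two different ones of these images; "fractal" means both that the topological dimension of $\tilde S$ differs from $\alpha_0$ and that $\alpha_0$ is not an integer. -/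

import Mathlib

open MeasureTheory
open scoped ENNReal NNReal

/-- The combination `u…uc` of digits: `c - 1` copies of `u`, followed by `c`. -/
def digitBlock {s : ℕ} (u c : Fin s) : List (Fin s) :=
  List.replicate ((c : ℕ) - 1) u ++ [c]

/-- The admissible combinations of `s`-adic digits: all `u…uc` with `c ≠ 0` and `c ≠ u`. -/
def admissibleBlocks (s : ℕ) : Set (List (Fin s)) :=
  {w | ∃ u c : Fin s, (c : ℕ) ≠ 0 ∧ c ≠ u ∧ w = digitBlock u c}

/-- The infinite word `d` is a concatenation of (nonempty) finite words from `W`: there are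
cutting positions `0 = t 0 < t 1 < t 2 < ⋯` such that each of the words
`d (t n), …, d (t (n + 1) - 1)` belongs to `W`. -/
def IsConcatenationOf {A : Type*} (W : Set (List A)) (d : ℕ → A) : Prop :=
  ∃ t : ℕ → ℕ, t 0 = 0 ∧ StrictMono t ∧
    ∀ n, (List.Ico (t n) (t (n + 1))).map d ∈ W

/-- The set of all numbers having an `s`-adic representation
`d 0 / s + d 1 / s ^ 2 + d 2 / s ^ 3 + ⋯` that consists only of admissible combinations
of digits. -/
def tildeS (s : ℕ) : Set ℝ :=
  {x | ∃ d : ℕ → Fin s, IsConcatenationOf (admissibleBlocks s) d ∧ x = Real.ofDigits d}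

/-- `K` is self-similar: a nonempty compact set which is the union of its images under finitely
many (at least two) contracting similarities, the images overlapping only negligibly, i.e.
`K` has positive `D`-dimensional Hausdorff measure and the overlaps have measure zero,
where `D` is the Hausdorff dimension of `K`. -/
def IsSelfSimilar (K : Set ℝ) : Prop :=
  K.Nonempty ∧ IsCompact K ∧
    ∃ (m : ℕ) (f : Fin m → ℝ → ℝ) (r : Fin m → ℝ),
      2 ≤ m ∧
      (∀ i, 0 < r i ∧ r i < 1) ∧
      (∀ i x y, dist (f i x) (f i y) = r i * dist x y) ∧
      K = ⋃ i, f i '' K ∧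
      0 < Measure.hausdorffMeasure (dimH K).toReal K ∧
      ∀ i j, i ≠ j → Measure.hausdorffMeasure (dimH K).toReal (f i '' K ∩ f j '' K) = 0

/-- `K` is a fractal in the wide sense: its topological dimension differs from its
Hausdorff dimension. -/
def IsFractalWide (K : Set ℝ) : Prop :=
  (smallInductiveDimension K).map ENat.toENNReal ≠ (dimH K : WithBot ℝ≥0∞)

/-- `K` is a fractal in the narrow sense: its Hausdorff dimension is fractional,
i.e. a real number that is not an integer. -/
def IsFractalNarrow (K : Set ℝ) : Prop :=
  dimH K ≠ ∞ ∧ ∀ n : ℕ, dimH K ≠ (n : ℝ≥0∞)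

/-!
Prepending a block `w` to `s`-adic representations is a similarity of ratio `s ^ (-|w|)`, so
`tildeS s` is the attractor of finitely many similarities. Its representations have infinitely many
nonzero digits, hence are unique, and the pieces of the attractor are disjoint as soon as a
concatenation of blocks determines its first block. Moran's theorem then applies: covering by cells
bounds the Hausdorff measure from above, and the Bernoulli measure giving the `i`-th piece the mass
`r i ^ α` bounds it from below. There is one block of length `1`, and there are `s - 1` of each
length `2, …, s - 1`, so `∑ i, r i ^ α = 1` is the stated equation.

The blocks do not form a prefix code, but the only competing first blocks are `1` and `1…1c`. If
both occur, stripping the ones from the first factorization shows that `c e` and `e` are both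
concatenations of blocks, for some digit `c ≥ 2`. This is impossible: the first block of `c e` is
`c…cb` with `b ≠ c` equal to its length `k`; if `k > 2`, the first block of `e` is this block
without its first letter, which requires `b = k - 1`. So `k = 2` and `e = 2 e'` with `2 ≠ c`, and
the same reasoning for `2 e'` and `e'` yields `2 ≠ 2`.
-/

open Filter Function PiNat Topology

section WordMap

variable {X I : Type*} {f : I → X → X} {K : Set X}

/-- The composition of the maps `f i` along the word `w`, the first letter of `w` being applied
first: `PiNat.res ω n` lists the first `n` letters of `ω` backwards, so that
`wordMap f (res ω n) = f (ω 0) ∘ ⋯ ∘ f (ω (n - 1))` addresses the cells of the attractor. -/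
def wordMap (f : I → X → X) (w : List I) (x : X) : X :=
  w.foldl (fun y i => f i y) x

theorem wordMap_cons_image (f : I → X → X) (i : I) (w : List I) (K : Set X) :
    wordMap f (i :: w) '' K = wordMap f w '' (f i '' K) :=
  Set.image_comp (wordMap f w) (f i) K

theorem subset_iUnion_wordMap_image (hK : K ⊆ ⋃ i, f i '' K) (n : ℕ) :
    K ⊆ ⋃ w : Fin n → I, wordMap f (List.ofFn w) '' K := by
  induction n with
  | zero => exact fun x hx => Set.mem_iUnion.2 ⟨Fin.elim0, x, hx, rfl⟩
  | succ n ih =>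
    intro x hx
    obtain ⟨w, y, hy, rfl⟩ := Set.mem_iUnion.1 (ih hx)
    obtain ⟨i, hi⟩ := Set.mem_iUnion.1 (hK hy)
    refine Set.mem_iUnion.2 ⟨Fin.cons i w, ?_⟩
    rw [List.ofFn_cons, wordMap_cons_image]
    exact Set.mem_image_of_mem _ hi

theorem continuous_wordMap [TopologicalSpace X] (hf : ∀ i, Continuous (f i)) :
    ∀ w, Continuous (wordMap f w)
  | [] => continuous_id
  | i :: w => (continuous_wordMap hf w).comp (hf i)

theorem lipschitzWith_wordMap [PseudoEMetricSpace X] {r : I → ℝ≥0}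
    (hf : ∀ i, LipschitzWith (r i) (f i)) : ∀ w, LipschitzWith (w.map r).prod (wordMap f w)
  | [] => LipschitzWith.id
  | i :: w => by
    rw [List.map_cons, List.prod_cons, mul_comm]
    exact (lipschitzWith_wordMap hf w).comp (hf i)

theorem le_edist_wordMap [PseudoEMetricSpace X] {r : I → ℝ≥0}
    (hf : ∀ i x y, r i * edist x y ≤ edist (f i x) (f i y)) (w : List I) (x y : X) :
    (w.map r).prod * edist x y ≤ edist (wordMap f w x) (wordMap f w y) := by
  induction w generalizing x y with
  | nil => simp [wordMap]
  | cons i w ih =>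
    calc ((List.map r (i :: w)).prod : ℝ≥0∞) * edist x y
        = (w.map r).prod * (r i * edist x y) := by
          rw [List.map_cons, List.prod_cons, ENNReal.coe_mul]; ring
      _ ≤ (w.map r).prod * edist (f i x) (f i y) := by gcongr; exact hf i x y
      _ ≤ edist (wordMap f (i :: w) x) (wordMap f (i :: w) y) := ih _ _

theorem ediam_wordMap_image_le [PseudoEMetricSpace X] {r : I → ℝ≥0} {ρ : ℝ≥0}
    (hf : ∀ i, LipschitzWith (r i) (f i)) (hρ : ∀ i, r i ≤ ρ) (w : List I) :
    Metric.ediam (wordMap f w '' K) ≤ ρ ^ w.length * Metric.ediam K := by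
  refine ((lipschitzWith_wordMap hf w).ediam_image_le K).trans ?_
  gcongr
  have h : (w.map r).prod ≤ ρ ^ (w.map r).length :=
    List.prod_le_pow_card _ _ (List.forall_mem_map.2 fun i _ => hρ i)
  rw [List.length_map] at h
  exact_mod_cast h

end WordMap

theorem exists_lt_one_forall_le {I : Type*} [Finite I] {r : I → ℝ≥0} (hr : ∀ i, r i < 1) :
    ∃ ρ < 1, ∀ i, r i ≤ ρ := by
  have := Fintype.ofFinite I
  exact ⟨Finset.univ.sup r, (Finset.sup_lt_iff one_pos).2 fun i _ => hr i,
    fun i => Finset.le_sup (Finset.mem_univ i)⟩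

theorem tendsto_pow_mul_atTop_nhds_zero {ρ : ℝ≥0} (hρ : ρ < 1) {D : ℝ≥0∞} (hD : D ≠ ∞) :
    Tendsto (fun n : ℕ => (ρ : ℝ≥0∞) ^ n * D) atTop (𝓝 0) := by
  simpa only [zero_mul] using ENNReal.Tendsto.mul_const
    (ENNReal.tendsto_pow_atTop_nhds_zero_of_lt_one (ENNReal.coe_lt_one_iff.2 hρ)) (Or.inr hD)

section UpperBound

variable {X I : Type*} [EMetricSpace X] [Fintype I] {f : I → X → X} {r : I → ℝ≥0} {K : Set X}
  {α : ℝ}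

theorem sum_ediam_wordMap_image_rpow_le (hf : ∀ i, LipschitzWith (r i) (f i)) (hα : 0 ≤ α)
    (hsum : ∑ i, r i ^ α ≤ 1) (n : ℕ) :
    ∑ w : Fin n → I, Metric.ediam (wordMap f (List.ofFn w) '' K) ^ α ≤ Metric.ediam K ^ α := by
  have hpow : ∑ w : Fin n → I, (∏ k, r (w k)) ^ α ≤ 1 := by
    simp only [← NNReal.finsetProd_rpow]
    rw [← Fintype.sum_pow fun i => r i ^ α]
    exact pow_le_one₀ zero_le hsum
  calc ∑ w : Fin n → I, Metric.ediam (wordMap f (List.ofFn w) '' K) ^ α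
      ≤ ∑ w : Fin n → I, ((∏ k, r (w k) : ℝ≥0) * Metric.ediam K) ^ α := by
        gcongr with w
        simpa only [List.map_ofFn, List.prod_ofFn, comp_apply] using
          (lipschitzWith_wordMap hf (List.ofFn w)).ediam_image_le K
    _ = (∑ w : Fin n → I, (∏ k, r (w k)) ^ α : ℝ≥0) * Metric.ediam K ^ α := by
        simp only [ENNReal.mul_rpow_of_nonneg _ _ hα, ← Finset.sum_mul,
          ENNReal.ofNNReal_finsetSum, ENNReal.coe_rpow_of_nonneg _ hα]
    _ ≤ Metric.ediam K ^ α := mul_le_of_le_one_left' (ENNReal.coe_le_one_iff.2 hpow)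

theorem hausdorffMeasure_le_ediam_rpow [MeasurableSpace X] [BorelSpace X]
    (hf : ∀ i, LipschitzWith (r i) (f i)) (hr : ∀ i, r i < 1) (hKd : Metric.ediam K ≠ ∞)
    (hK : K ⊆ ⋃ i, f i '' K) (hα : 0 ≤ α) (hsum : ∑ i, r i ^ α ≤ 1) :
    Measure.hausdorffMeasure α K ≤ Metric.ediam K ^ α := by
  obtain ⟨ρ, hρ1, hρ⟩ := exists_lt_one_forall_le hr
  calc Measure.hausdorffMeasure α K
      ≤ liminf (fun n => ∑ w : Fin n → I, Metric.ediam (wordMap f (List.ofFn w) '' K) ^ α)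
          atTop :=
        Measure.hausdorffMeasure_le_liminf_sum α K _ (tendsto_pow_mul_atTop_nhds_zero hρ1 hKd) _
          (.of_forall fun n w => by
            simpa only [List.length_ofFn] using ediam_wordMap_image_le hf hρ (List.ofFn w))
          (.of_forall (subset_iUnion_wordMap_image hK))
    _ ≤ liminf (fun _ => Metric.ediam K ^ α) atTop :=
        liminf_le_liminf (.of_forall (sum_ediam_wordMap_image_rpow_le hf hα hsum))
    _ = Metric.ediam K ^ α := liminf_const _

end UpperBound

section Coding

variable {X I : Type*} {f : I → X → X} {r : I → ℝ≥0} {K : Set X} {π : (ℕ → I) → X}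

theorem exists_coding [TopologicalSpace X] [T2Space X] (hf : ∀ i, Continuous (f i))
    (hKc : IsCompact K) (hKn : K.Nonempty) (hmaps : ∀ i, f i '' K ⊆ K) :
    ∃ π : (ℕ → I) → X, ∀ ω n, π ω ∈ wordMap f (res ω n) '' K := by
  have hcompact : ∀ w, IsCompact (wordMap f w '' K) := fun w => hKc.image (continuous_wordMap hf w)
  have hmem : ∀ ω : ℕ → I, (⋂ n, wordMap f (res ω n) '' K).Nonempty := fun ω => by
    refine IsCompact.nonempty_iInter_of_sequence_nonempty_isCompact_isClosed _ (fun n => ?_)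
      (fun n => hKn.image _) (hcompact _) (fun n => (hcompact _).isClosed)
    rw [res_succ, wordMap_cons_image]
    exact Set.image_mono (hmaps _)
  choose π hπ using hmem
  exact ⟨π, fun ω => Set.mem_iInter.1 (hπ ω)⟩

theorem continuous_coding [PseudoEMetricSpace X] [Finite I] [TopologicalSpace I]
    [DiscreteTopology I] (hf : ∀ i, LipschitzWith (r i) (f i)) (hr : ∀ i, r i < 1)
    (hKd : Metric.ediam K ≠ ∞) (hπ : ∀ ω n, π ω ∈ wordMap f (res ω n) '' K) : Continuous π := by
  obtain ⟨ρ, hρ1, hρ⟩ := exists_lt_one_forall_le hr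
  refine continuous_iff_continuousAt.2 fun ω => EMetric.tendsto_nhds.2 fun ε hε => ?_
  obtain ⟨n, hn⟩ := ((tendsto_pow_mul_atTop_nhds_zero hρ1 hKd).eventually_lt_const hε).exists
  filter_upwards [(isOpen_cylinder _ ω n).mem_nhds (self_mem_cylinder ω n)] with ω' hω'
  have hres : res ω' n = res ω n := by rwa [cylinder_eq_res] at hω'
  calc edist (π ω') (π ω)
      ≤ Metric.ediam (wordMap f (res ω n) '' K) :=
        Metric.edist_le_ediam_of_mem (hres ▸ hπ ω' n) (hπ ω n)
    _ ≤ ρ ^ n * Metric.ediam K := by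
        simpa only [res_length] using ediam_wordMap_image_le hf hρ (res ω n)
    _ < ε := hn

theorem le_edist_coding [PseudoEMetricSpace X] {δ : ℝ≥0}
    (hf : ∀ i x y, r i * edist x y ≤ edist (f i x) (f i y))
    (hδ : Pairwise fun i j => ∀ x ∈ f i '' K, ∀ y ∈ f j '' K, δ ≤ edist x y)
    (hπ : ∀ ω n, π ω ∈ wordMap f (res ω n) '' K) {ω ω' : ℕ → I} {n : ℕ}
    (hω' : ω' ∈ cylinder ω n) (hne : ω n ≠ ω' n) :
    δ * ((res ω n).map r).prod ≤ edist (π ω) (π ω') := by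
  have hres : res ω' n = res ω n := by rwa [cylinder_eq_res] at hω'
  have hmem : ∀ υ, π υ ∈ wordMap f (res υ n) '' (f (υ n) '' K) := fun υ => by
    rw [← wordMap_cons_image, ← res_succ]
    exact hπ υ (n + 1)
  obtain ⟨x, hx, hxω⟩ := hmem ω
  obtain ⟨y, hy, hyω'⟩ := hmem ω'
  rw [hres] at hyω'
  calc (δ : ℝ≥0∞) * ((res ω n).map r).prod
      ≤ ((res ω n).map r).prod * edist x y := by
        rw [mul_comm]
        gcongr
        exact hδ hne x hx y hy
    _ ≤ edist (π ω) (π ω') := by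
        rw [← hxω, ← hyω']
        exact le_edist_wordMap hf _ x y

end Coding

theorem exists_pos_forall_le_edist {X I : Type*} [EMetricSpace X] [Finite I] {E : I → Set X}
    (hE : ∀ i, IsCompact (E i)) (hdisj : Pairwise fun i j => Disjoint (E i) (E j)) :
    ∃ δ : ℝ≥0, 0 < δ ∧ Pairwise fun i j => ∀ x ∈ E i, ∀ y ∈ E j, δ ≤ edist x y := by
  have hpair : ∀ i j, ∀ᶠ δ : ℝ≥0 in 𝓝[>] 0, i ≠ j → ∀ x ∈ E i, ∀ y ∈ E j, δ ≤ edist x y := by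
    intro i j
    by_cases hij : i = j
    · exact .of_forall fun _ h => absurd hij h
    obtain ⟨δ₀, hδ₀, h⟩ :=
      Metric.exists_pos_forall_lt_edist (hE i) (hE j).isClosed (hdisj hij)
    filter_upwards [Ioo_mem_nhdsGT hδ₀] with δ hδ _ x hx y hy
    exact (ENNReal.coe_le_coe.2 hδ.2.le).trans (h x hx y hy).le
  obtain ⟨δ, h, hδ⟩ := ((eventually_all.2 fun i => eventually_all.2 (hpair i)).and
    (self_mem_nhdsWithin (s := Set.Ioi 0))).exists
  exact ⟨δ, hδ, h⟩

section BernoulliMeasure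

variable {I : Type*} [MeasurableSpace I] [MeasurableSingletonClass I] {ν : Measure I}
  [IsProbabilityMeasure ν]

theorem infinitePi_const_cylinder (ω : ℕ → I) (n : ℕ) :
    Measure.infinitePi (fun _ : ℕ => ν) (cylinder ω n) =
      ((res ω n).map fun i => ν {i}).prod := by
  rw [cylinder_eq_pi, Measure.infinitePi_pi _ fun k _ => measurableSet_singleton _]
  induction n with
  | zero => simp
  | succ n ih => rw [Finset.prod_range_succ, ih, res_succ, List.map_cons, List.prod_cons, mul_comm]

theorem nullSingletonClass_infinitePi_const [Finite I] (hν : ∀ i, ν {i} < 1) :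
    NullSingletonClass (Measure.infinitePi fun _ : ℕ => ν) := by
  obtain ⟨ρ, hρ1, hρ⟩ := exists_lt_one_forall_le (r := fun i => (ν {i}).toNNReal)
    fun i => (ENNReal.toNNReal_lt_toNNReal (measure_ne_top _ _) ENNReal.one_ne_top).2 (hν i)
  refine ⟨fun ω => le_antisymm (ge_of_tendsto' (ENNReal.tendsto_pow_atTop_nhds_zero_of_lt_one
    (ENNReal.coe_lt_one_iff.2 hρ1)) fun n => ?_) zero_le⟩
  calc Measure.infinitePi (fun _ : ℕ => ν) {ω}
      ≤ Measure.infinitePi (fun _ : ℕ => ν) (cylinder ω n) :=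
        measure_mono (Set.singleton_subset_iff.2 (self_mem_cylinder ω n))
    _ = ((res ω n).map fun i => ν {i}).prod := infinitePi_const_cylinder ω n
    _ ≤ (ρ : ℝ≥0∞) ^ n := by
        have h := List.prod_le_pow_card ((res ω n).map fun i => ν {i}) (ρ : ℝ≥0∞)
          (List.forall_mem_map.2 fun i _ =>
            ENNReal.coe_toNNReal (measure_ne_top ν {i}) ▸ ENNReal.coe_le_coe.2 (hρ i))
        rwa [List.length_map, res_length] at h

end BernoulliMeasure

theorem exists_subset_cylinder_and_apply_ne {I : Type*} {V : Set (ℕ → I)} (hV : V.Nontrivial) :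
    ∃ ω ∈ V, ∃ ω' ∈ V, ∃ n, V ⊆ cylinder ω n ∧ ω n ≠ ω' n := by
  classical
  have hex : ∃ n, ∃ ω ∈ V, ∃ ω' ∈ V, ω n ≠ ω' n := by
    obtain ⟨ω, hω, ω', hω', hne⟩ := hV
    obtain ⟨n, hn⟩ := Function.ne_iff.1 hne
    exact ⟨n, ω, hω, ω', hω', hn⟩
  obtain ⟨ω, hω, ω', hω', hne⟩ := Nat.find_spec hex
  refine ⟨ω, hω, ω', hω', Nat.find hex, fun υ hυ k hk => ?_, hne⟩
  by_contra h
  exact Nat.find_min hex hk ⟨υ, hυ, ω, hω, h⟩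

theorem mul_infinitePi_le_ediam_image_coding_rpow {X I : Type*} [EMetricSpace X] [Finite I]
    [MeasurableSpace I] [MeasurableSingletonClass I] {ν : Measure I} [IsProbabilityMeasure ν]
    {f : I → X → X} {r : I → ℝ≥0} {K : Set X} {α : ℝ} {π : (ℕ → I) → X} {δ : ℝ≥0}
    (hf : ∀ i x y, r i * edist x y ≤ edist (f i x) (f i y)) (hr : ∀ i, r i < 1)
    (hδ : Pairwise fun i j => ∀ x ∈ f i '' K, ∀ y ∈ f j '' K, δ ≤ edist x y)
    (hπ : ∀ ω n, π ω ∈ wordMap f (res ω n) '' K) (hα : 0 < α)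
    (hν : ∀ i, ν {i} = (r i : ℝ≥0∞) ^ α) (V : Set (ℕ → I)) :
    (δ : ℝ≥0∞) ^ α * Measure.infinitePi (fun _ : ℕ => ν) V ≤ Metric.ediam (π '' V) ^ α := by
  have := nullSingletonClass_infinitePi_const (ν := ν) fun i => by
    rw [hν]
    exact ENNReal.rpow_lt_one (ENNReal.coe_lt_one_iff.2 (hr i)) hα
  rcases V.subsingleton_or_nontrivial with hV | hV
  · rw [hV.measure_zero, mul_zero]
    exact zero_le
  obtain ⟨ω, hω, ω', hω', n, hsub, hne⟩ := exists_subset_cylinder_and_apply_ne hV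
  have hprod : ((res ω n).map fun i => ν {i}).prod = (((res ω n).map r).prod : ℝ≥0∞) ^ α := by
    simp only [hν]
    induction res ω n with
    | nil => simp
    | cons i w ih => simp [ih, ENNReal.mul_rpow_of_nonneg _ _ hα.le]
  calc (δ : ℝ≥0∞) ^ α * Measure.infinitePi (fun _ : ℕ => ν) V
      ≤ (δ : ℝ≥0∞) ^ α * Measure.infinitePi (fun _ : ℕ => ν) (cylinder ω n) := by gcongr
    _ = ((δ : ℝ≥0∞) * ((res ω n).map r).prod) ^ α := by
        rw [infinitePi_const_cylinder, hprod, ENNReal.mul_rpow_of_nonneg _ _ hα.le]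
    _ ≤ edist (π ω) (π ω') ^ α := by
        gcongr
        exact le_edist_coding hf hδ hπ (hsub hω') hne
    _ ≤ Metric.ediam (π '' V) ^ α := by
        gcongr
        exact Metric.edist_le_ediam_of_mem (Set.mem_image_of_mem π hω) (Set.mem_image_of_mem π hω')

section Moran

variable {X I : Type*} [MetricSpace X] [MeasurableSpace X] [BorelSpace X] [Fintype I]
  {f : I → X → X} {r : I → ℝ≥0} {K : Set X}

theorem hausdorffMeasure_pos_of_pairwise_disjoint {α : ℝ}
    (hf : ∀ i x y, edist (f i x) (f i y) = r i * edist x y) (hr : ∀ i, r i < 1)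
    (hKc : IsCompact K) (hKn : K.Nonempty) (hmaps : ∀ i, f i '' K ⊆ K)
    (hdisj : Pairwise fun i j => Disjoint (f i '' K) (f j '' K)) (hα : 0 < α)
    (hsum : ∑ i, r i ^ α = 1) : 0 < Measure.hausdorffMeasure α K := by
  have hlip : ∀ i, LipschitzWith (r i) (f i) := fun i x y => (hf i x y).le
  obtain ⟨π, hπ⟩ := exists_coding (fun i => (hlip i).continuous) hKc hKn hmaps
  obtain ⟨δ, hδ0, hδ⟩ :=
    exists_pos_forall_le_edist (fun i => hKc.image (hlip i).continuous) hdisj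
  let _ : TopologicalSpace I := ⊥
  have : DiscreteTopology I := ⟨rfl⟩
  let _ : MeasurableSpace I := ⊤
  have : BorelSpace I := ⟨borel_eq_top_of_discrete.symm⟩
  have hsum' : ∑ i, (r i : ℝ≥0∞) ^ α = 1 := by
    simp only [← ENNReal.coe_rpow_of_nonneg _ hα.le]
    exact_mod_cast hsum
  let p : PMF I := PMF.ofFintype (fun i => (r i : ℝ≥0∞) ^ α) hsum'
  let μ : Measure (ℕ → I) := Measure.infinitePi fun _ => p.toMeasure
  have hmeas : Measurable π := (continuous_coding hlip hr hKc.isBounded.ediam_ne_top hπ).measurable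
  have hbound : (δ : ℝ≥0∞) ^ α • μ.map π ≤ Measure.hausdorffMeasure α := by
    refine Measure.le_hausdorffMeasure α _ 1 one_pos fun V _ => ?_
    calc (δ : ℝ≥0∞) ^ α * μ.map π V
        ≤ (δ : ℝ≥0∞) ^ α * μ (π ⁻¹' closure V) := by
          rw [← Measure.map_apply hmeas isClosed_closure.measurableSet]
          gcongr
          exact subset_closure
      _ ≤ Metric.ediam (π '' (π ⁻¹' closure V)) ^ α :=
          mul_infinitePi_le_ediam_image_coding_rpow (fun i x y => (hf i x y).ge) hr hδ hπ hα
            (fun i => p.toMeasure_apply_singleton i (measurableSet_singleton i)) _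
      _ ≤ Metric.ediam V ^ α := by
          rw [← Metric.ediam_closure V]
          gcongr
          exact Set.image_preimage_subset π _
  have hpre : π ⁻¹' K = Set.univ := Set.eq_univ_of_forall fun ω => by
    simpa [wordMap] using hπ ω 0
  calc 0 < (δ : ℝ≥0∞) ^ α := ENNReal.rpow_pos (ENNReal.coe_pos.2 hδ0) ENNReal.coe_ne_top
    _ = ((δ : ℝ≥0∞) ^ α • μ.map π) K := by
        rw [Measure.smul_apply, Measure.map_apply hmeas hKc.measurableSet, hpre, measure_univ,
          smul_eq_mul, mul_one]
    _ ≤ Measure.hausdorffMeasure α K := hbound K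

theorem dimH_eq_of_pairwise_disjoint {α : ℝ≥0}
    (hf : ∀ i x y, edist (f i x) (f i y) = r i * edist x y) (hr : ∀ i, r i < 1)
    (hKc : IsCompact K) (hKn : K.Nonempty) (hK : K = ⋃ i, f i '' K)
    (hdisj : Pairwise fun i j => Disjoint (f i '' K) (f j '' K)) (hα : 0 < α)
    (hsum : ∑ i, r i ^ (α : ℝ) = 1) : dimH K = α := by
  have hle := hausdorffMeasure_le_ediam_rpow (fun i x y => (hf i x y).le) hr
    hKc.isBounded.ediam_ne_top hK.subset α.2 hsum.le
  have hpos := hausdorffMeasure_pos_of_pairwise_disjoint hf hr hKc hKn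
    (fun i => (Set.subset_iUnion _ i).trans hK.superset) hdisj hα hsum
  exact dimH_of_hausdorffMeasure_ne_zero_ne_top hpos.ne'
    (ne_top_of_le_ne_top (ENNReal.rpow_ne_top_of_nonneg α.2 hKc.isBounded.ediam_ne_top) hle)

end Moran

theorem nontrivial_of_sum_rpow_eq_one {I : Type*} [Fintype I] {r : I → ℝ≥0} {α : ℝ}
    (hr : ∀ i, r i < 1) (hα : 0 < α) (hsum : ∑ i, r i ^ α = 1) : Nontrivial I := by
  by_contra h
  have := not_nontrivial_iff_subsingleton.1 h
  obtain ⟨i, -⟩ := Finset.exists_ne_zero_of_sum_ne_zero (hsum.trans_ne one_ne_zero)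
  rw [Fintype.sum_subsingleton _ i] at hsum
  exact (NNReal.rpow_lt_one (hr i) hα).ne hsum

theorem isSelfSimilar_of_pairwise_disjoint {I : Type*} [Fintype I]
    {f : I → ℝ → ℝ} {r : I → ℝ≥0} {K : Set ℝ} {α : ℝ≥0}
    (hf : ∀ i x y, edist (f i x) (f i y) = r i * edist x y) (hr₀ : ∀ i, 0 < r i)
    (hr : ∀ i, r i < 1) (hKc : IsCompact K) (hKn : K.Nonempty) (hK : K = ⋃ i, f i '' K)
    (hdisj : Pairwise fun i j => Disjoint (f i '' K) (f j '' K)) (hα : 0 < α)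
    (hsum : ∑ i, r i ^ (α : ℝ) = 1) : IsSelfSimilar K := by
  have hpos := hausdorffMeasure_pos_of_pairwise_disjoint hf hr hKc hKn
    (fun i => (Set.subset_iUnion _ i).trans hK.superset) hdisj hα hsum
  have := nontrivial_of_sum_rpow_eq_one hr hα hsum
  let e := (Fintype.equivFin I).symm
  refine ⟨hKn, hKc, Fintype.card I, f ∘ e, fun i => r (e i), Fintype.one_lt_card,
    fun i => ⟨hr₀ _, hr _⟩, fun i x y => ?_, hK.trans (e.iSup_comp (g := fun i => f i '' K)).symm,
    ?_, fun i j hij => ?_⟩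
  · rw [comp_apply, dist_edist, hf, ENNReal.toReal_mul, ENNReal.coe_toReal, ← dist_edist]
  · rwa [dimH_eq_of_pairwise_disjoint hf hr hKc hKn hK hdisj hα hsum, ENNReal.coe_toReal]
  · rw [comp_apply, comp_apply, (hdisj (e.injective.ne hij)).inter_eq, measure_empty]

section InfiniteWord

variable {A : Type*}

/-- The infinite word with first letter `a` followed by the infinite word `d`. This is
`Stream'.cons`, restated for `ℕ → A` in order to have the product topology at hand. -/
def seqCons (a : A) (d : ℕ → A) : ℕ → A :=
  Stream'.cons a d

/-- The infinite word consisting of the finite word `w` followed by the infinite word `d`. This is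
`Stream'.appendStream'`, restated for `ℕ → A` in order to have the product topology at hand. -/
def seqAppend (w : List A) (d : ℕ → A) : ℕ → A :=
  Stream'.appendStream' w d

theorem seqCons_inj {a b : A} {d e : ℕ → A} : seqCons a d = seqCons b e ↔ a = b ∧ d = e :=
  Stream'.cons_injective2.eq_iff

theorem seqCons_head_tail (d : ℕ → A) : seqCons (d 0) (fun n => d (n + 1)) = d :=
  Stream'.eta d

theorem nil_seqAppend (d : ℕ → A) : seqAppend [] d = d :=
  rfl

theorem cons_seqAppend (a : A) (w : List A) (d : ℕ → A) :
    seqAppend (a :: w) d = seqCons a (seqAppend w d) :=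
  rfl

theorem append_seqAppend (v w : List A) (d : ℕ → A) :
    seqAppend (v ++ w) d = seqAppend v (seqAppend w d) :=
  Stream'.append_append_stream v w d

theorem eq_of_seqAppend_eq {v w : List A} {d e : ℕ → A} (h : seqAppend v d = seqAppend w e)
    (hl : v.length = w.length) : v = w :=
  Stream'.append_left_injective v w d e h hl

theorem seqAppend_length_add (w : List A) (d : ℕ → A) (n : ℕ) :
    seqAppend w d (w.length + n) = d n :=
  Stream'.get_append_right n w d

theorem continuous_seqAppend [TopologicalSpace A] (w : List A) :
    Continuous (seqAppend w) := by
  induction w with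
  | nil => exact continuous_id
  | cons a w ih =>
    refine continuous_pi fun n => ?_
    cases n with
    | zero => exact continuous_const
    | succ n => exact (continuous_apply n).comp ih

theorem map_listIco_add_eq_map_range (d : ℕ → A) (m n : ℕ) :
    (List.Ico m (m + n)).map d = (List.range n).map fun k => d (m + k) := by
  rw [List.Ico, Nat.add_sub_cancel_left, List.range'_eq_map_range, List.map_map, comp_def]

theorem map_range_seqAppend (d : ℕ → A) (n : ℕ) :
    seqAppend ((List.range n).map d) (fun k => d (k + n)) = d := by
  induction n generalizing d with
  | zero => rfl
  | succ n ih =>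
    rw [List.range_succ_eq_map, List.map_cons, List.map_map]
    refine (congrArg (seqCons (d 0)) (ih fun k => d (k + 1))).trans (funext fun k => ?_)
    cases k <;> rfl

theorem map_range_length_seqAppend (w : List A) (d : ℕ → A) :
    (List.range w.length).map (seqAppend w d) = w := by
  induction w with
  | nil => rfl
  | cons a w ih =>
    rw [List.length_cons, List.range_succ_eq_map, List.map_cons, List.map_map]
    exact congrArg (a :: ·) ih

end InfiniteWord

section Concatenation

variable {A : Type*} {W : Set (List A)}

/-- The set of all infinite concatenations of words from `W`. -/
def concatenations (W : Set (List A)) : Set (ℕ → A) :=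
  {d | IsConcatenationOf W d}

theorem exists_eq_seqAppend_of_mem_concatenations {d : ℕ → A} (hd : d ∈ concatenations W) :
    ∃ w ∈ W, w ≠ [] ∧ ∃ e ∈ concatenations W, d = seqAppend w e := by
  obtain ⟨t, ht0, hmono, hW⟩ := hd
  have hle : ∀ n, t 1 ≤ t (n + 1) := fun n => hmono.monotone (Nat.le_add_left 1 n)
  have hfirst := hW 0
  rw [ht0, List.Ico.zero_bot] at hfirst
  refine ⟨_, hfirst, ?_, fun k => d (k + t 1), ⟨fun n => t (n + 1) - t 1, Nat.sub_self _,
    strictMono_nat_of_lt_succ fun n => Nat.sub_lt_sub_right (hle n) (hmono (Nat.lt_succ_self _)),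
    fun n => ?_⟩, (map_range_seqAppend d (t 1)).symm⟩
  · rw [← List.length_pos_iff, List.length_map, List.length_range]
    exact ht0.symm.trans_lt (hmono Nat.zero_lt_one)
  · have h := List.Ico.map_add (t (n + 1) - t 1) (t (n + 2) - t 1) (t 1)
    rw [Nat.sub_add_cancel (hle n), Nat.sub_add_cancel (hle (n + 1))] at h
    have hword := hW (n + 1)
    simpa only [← h, List.map_map, comp_def, add_comm (t 1)] using hword

theorem subset_concatenations {P : Set (ℕ → A)}
    (hP : ∀ d ∈ P, ∃ w ∈ W, w ≠ [] ∧ ∃ e ∈ P, d = seqAppend w e) : P ⊆ concatenations W := by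
  intro d hd
  choose! w hwW hw next hnext hdec using hP
  have hmem : ∀ n, next^[n] d ∈ P := fun n => (show Set.MapsTo next P P from hnext).iterate n hd
  let t : ℕ → ℕ := fun n => ∑ k ∈ Finset.range n, (w (next^[k] d)).length
  have hsucc : ∀ n, t (n + 1) = t n + (w (next^[n] d)).length := fun n =>
    Finset.sum_range_succ _ n
  have hdrop : ∀ n k, d (t n + k) = next^[n] d k := by
    intro n
    induction n with
    | zero => simp [t]
    | succ n ih =>
      intro k
      rw [hsucc, add_assoc, ih, iterate_succ_apply']
      exact (congrFun (hdec _ (hmem n)) _).trans (seqAppend_length_add _ _ _)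
  refine ⟨t, rfl, strictMono_nat_of_lt_succ fun n => ?_, fun n => ?_⟩
  · rw [hsucc]
    exact Nat.lt_add_of_pos_right (List.length_pos_iff.2 (hw _ (hmem n)))
  · have hword := map_range_length_seqAppend (w (next^[n] d)) (next (next^[n] d))
    rw [← hdec _ (hmem n)] at hword
    simp only [hsucc, map_listIco_add_eq_map_range, hdrop, hword]
    exact hwW _ (hmem n)

theorem seqAppend_mem_concatenations {w : List A} (hw : w ∈ W) (hne : w ≠ []) {e : ℕ → A}
    (he : e ∈ concatenations W) : seqAppend w e ∈ concatenations W := by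
  have h : ∀ d ∈ insert (seqAppend w e) (concatenations W), ∃ v ∈ W, v ≠ [] ∧
      ∃ f ∈ insert (seqAppend w e) (concatenations W), d = seqAppend v f := by
    rintro d (rfl | hd)
    · exact ⟨w, hw, hne, e, Set.mem_insert_of_mem _ he, rfl⟩
    · obtain ⟨v, hv, hvne, f, hf, hd⟩ := exists_eq_seqAppend_of_mem_concatenations hd
      exact ⟨v, hv, hvne, f, Set.mem_insert_of_mem _ hf, hd⟩
  exact subset_concatenations h (Set.mem_insert _ _)

theorem concatenations_nonempty {w : List A} (hw : w ∈ W) (hne : w ≠ []) :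
    (concatenations W).Nonempty := by
  refine ⟨Stream'.cycle w hne, subset_concatenations (P := {Stream'.cycle w hne}) ?_ rfl⟩
  rintro _ rfl
  exact ⟨w, hw, hne, _, rfl, Stream'.cycle_eq w hne⟩

theorem frequently_of_mem_concatenations {p : A → Prop} (hW : ∀ w ∈ W, ∃ a ∈ w, p a)
    {d : ℕ → A} (hd : d ∈ concatenations W) : ∃ᶠ n in atTop, p (d n) := by
  obtain ⟨t, -, hmono, ht⟩ := hd
  refine frequently_atTop.2 fun N => ?_
  obtain ⟨a, ha, hpa⟩ := hW _ (ht N)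
  obtain ⟨n, hn, rfl⟩ := List.mem_map.1 ha
  exact ⟨n, hmono.le_apply.trans (List.Ico.mem.1 hn).1, hpa⟩

theorem isCompact_concatenations [TopologicalSpace A] [CompactSpace A] [T2Space A]
    (hW : W.Finite) : IsCompact (concatenations W) := by
  let P := closure (concatenations W)
  have hclosed : IsClosed (⋃ w ∈ W \ {[]}, seqAppend w '' P) :=
    (hW.subset Set.sdiff_subset).isClosed_biUnion fun w _ =>
      (isClosed_closure.isCompact.image (continuous_seqAppend w)).isClosed
  have hsub : concatenations W ⊆ ⋃ w ∈ W \ {[]}, seqAppend w '' P := by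
    intro d hd
    obtain ⟨w, hw, hne, e, he, rfl⟩ := exists_eq_seqAppend_of_mem_concatenations hd
    exact Set.mem_biUnion ⟨hw, hne⟩ ⟨e, subset_closure he, rfl⟩
  have hP : ∀ d ∈ P, ∃ w ∈ W, w ≠ [] ∧ ∃ e ∈ P, d = seqAppend w e := by
    intro d hd
    obtain ⟨w, ⟨hw, hne⟩, e, he, rfl⟩ := Set.mem_iUnion₂.1 (closure_minimal hsub hclosed hd)
    exact ⟨w, hw, hne, e, he, rfl⟩
  exact (isClosed_of_closure_subset (subset_concatenations hP)).isCompact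

/-- `W` is an `ω`-code: an infinite concatenation of words from `W` determines its first factor,
hence, inductively, its whole factorization. -/
def IsOmegaCode (W : Set (List A)) : Prop :=
  ∀ w ∈ W, ∀ w' ∈ W, ∀ d ∈ concatenations W, ∀ d' ∈ concatenations W,
    seqAppend w d = seqAppend w' d' → w = w'

end Concatenation

section DigitExpansion

variable {s : ℕ} {W : Set (List (Fin s))}

/-- The similarity of the line that prepends the digits `w` to the `s`-adic representation of a
number in `[0, 1]`. -/
noncomputable def digitMap (w : List (Fin s)) (x : ℝ) : ℝ :=
  w.foldr (fun (a : Fin s) y => ((a : ℕ) + y) / s) x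

theorem edist_digitMap (w : List (Fin s)) (x y : ℝ) :
    edist (digitMap w x) (digitMap w y) = ((s : ℝ≥0)⁻¹ ^ w.length : ℝ≥0) * edist x y := by
  induction w with
  | nil => simp [digitMap]
  | cons a w ih =>
    have hstep : ∀ x y : ℝ, edist (((a : ℕ) + x) / s) (((a : ℕ) + y) / s) =
        ((s : ℝ≥0)⁻¹ : ℝ≥0) * edist x y := fun x y => by
      simp only [edist_nndist, ← ENNReal.coe_mul, ENNReal.coe_inj, ← NNReal.coe_inj,
        NNReal.coe_mul, coe_nndist, NNReal.coe_inv, NNReal.coe_natCast, div_eq_inv_mul]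
      rw [Real.dist_eq, ← mul_sub, add_sub_add_left_eq_sub, abs_mul, abs_inv, Nat.abs_cast,
        Real.dist_eq]
    rw [List.length_cons, pow_succ', ENNReal.coe_mul, mul_assoc, ← ih]
    exact hstep _ _

theorem ofDigits_seqCons (a : Fin s) (d : ℕ → Fin s) :
    Real.ofDigits (seqCons a d) = ((a : ℕ) + Real.ofDigits d) / s := by
  rw [Real.ofDigits_eq_sum_add_ofDigits _ 1, Finset.sum_range_one, Real.ofDigitsTerm, zero_add,
    pow_one, ← div_eq_mul_inv, ← div_eq_inv_mul, ← add_div]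
  rfl

theorem ofDigits_seqAppend (w : List (Fin s)) (d : ℕ → Fin s) :
    Real.ofDigits (seqAppend w d) = digitMap w (Real.ofDigits d) := by
  induction w with
  | nil => rfl
  | cons a w ih => rw [cons_seqAppend, ofDigits_seqCons, ih, digitMap, digitMap, List.foldr_cons]

theorem ofDigits_pos {d : ℕ → Fin s} {n : ℕ} (hn : (d n : ℕ) ≠ 0) : 0 < Real.ofDigits d := by
  have hs : 0 < s := (d n).pos
  exact Real.summable_ofDigitsTerm.tsum_pos (fun _ => Real.ofDigitsTerm_nonneg) n
    (mul_pos (Nat.cast_pos.2 (Nat.pos_of_ne_zero hn)) (by positivity))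

theorem eq_of_ofDigits_seqCons_eq {a b : Fin s} {d e : ℕ → Fin s} (hd : 0 < Real.ofDigits d)
    (he : 0 < Real.ofDigits e) (h : Real.ofDigits (seqCons a d) = Real.ofDigits (seqCons b e)) :
    a = b ∧ Real.ofDigits d = Real.ofDigits e := by
  have hs : (s : ℝ) ≠ 0 := Nat.cast_ne_zero.2 a.pos.ne'
  rw [ofDigits_seqCons, ofDigits_seqCons, div_left_inj' hs] at h
  have hd1 := Real.ofDigits_le_one d
  have he1 := Real.ofDigits_le_one e
  have hab : (a : ℕ) < (b : ℕ) + 1 := by exact_mod_cast (by linarith : ((a : ℕ) : ℝ) < (b : ℕ) + 1)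
  have hba : (b : ℕ) < (a : ℕ) + 1 := by exact_mod_cast (by linarith : ((b : ℕ) : ℝ) < (a : ℕ) + 1)
  obtain rfl : a = b := Fin.ext (by lia)
  exact ⟨rfl, add_left_cancel h⟩

theorem injOn_ofDigits :
    Set.InjOn Real.ofDigits {d : ℕ → Fin s | ∃ᶠ n in atTop, (d n : ℕ) ≠ 0} := by
  have htail : ∀ d : ℕ → Fin s, (∃ᶠ n in atTop, (d n : ℕ) ≠ 0) →
      ∃ᶠ n in atTop, (d (n + 1) : ℕ) ≠ 0 := fun d hd => by
    rwa [← map_add_atTop_eq_nat 1, frequently_map] at hd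
  have hpos : ∀ d : ℕ → Fin s, (∃ᶠ n in atTop, (d n : ℕ) ≠ 0) →
      0 < Real.ofDigits fun n => d (n + 1) := fun d hd =>
    let ⟨_, hn⟩ := (htail d hd).exists
    ofDigits_pos hn
  intro d hd e he hde
  funext n
  induction n generalizing d e with
  | zero =>
    rw [← seqCons_head_tail d, ← seqCons_head_tail e] at hde
    exact (eq_of_ofDigits_seqCons_eq (hpos d hd) (hpos e he) hde).1
  | succ _ ih =>
    rw [← seqCons_head_tail d, ← seqCons_head_tail e] at hde
    exact ih (htail d hd) (htail e he) (eq_of_ofDigits_seqCons_eq (hpos d hd) (hpos e he) hde).2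

theorem isCompact_image_ofDigits_concatenations (hW : W.Finite) :
    IsCompact (Real.ofDigits '' concatenations W) :=
  (isCompact_concatenations hW).image Real.continuous_ofDigits

theorem image_ofDigits_concatenations_eq_iUnion (hW : [] ∉ W) :
    Real.ofDigits '' concatenations W =
      ⋃ w : W, digitMap w.1 '' (Real.ofDigits '' concatenations W) := by
  apply Set.Subset.antisymm
  · rintro _ ⟨d, hd, rfl⟩
    obtain ⟨w, hw, -, e, he, rfl⟩ := exists_eq_seqAppend_of_mem_concatenations hd
    exact Set.mem_iUnion.2 ⟨⟨w, hw⟩, _, ⟨e, he, rfl⟩, (ofDigits_seqAppend w e).symm⟩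
  · refine Set.iUnion_subset fun w => ?_
    rintro _ ⟨_, ⟨e, he, rfl⟩, rfl⟩
    exact ⟨seqAppend w e, seqAppend_mem_concatenations w.2 (ne_of_mem_of_not_mem w.2 hW) he,
      ofDigits_seqAppend w e⟩

theorem pairwise_disjoint_digitMap_image (hW : IsOmegaCode W)
    (h0 : ∀ w ∈ W, ∃ a ∈ w, (a : ℕ) ≠ 0) :
    Pairwise fun v w : W => Disjoint (digitMap v.1 '' (Real.ofDigits '' concatenations W))
      (digitMap w.1 '' (Real.ofDigits '' concatenations W)) := by
  have hfreq : ∀ w : W, ∀ d ∈ concatenations W,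
      seqAppend w.1 d ∈ {d : ℕ → Fin s | ∃ᶠ n in atTop, (d n : ℕ) ≠ 0} := fun w d hd => by
    obtain ⟨a, ha, -⟩ := h0 w w.2
    exact frequently_of_mem_concatenations (p := fun a : Fin s => (a : ℕ) ≠ 0) h0
      (seqAppend_mem_concatenations w.2 (List.ne_nil_of_mem ha) hd)
  refine fun v w hvw => Set.disjoint_left.2 ?_
  rintro _ ⟨_, ⟨d, hd, rfl⟩, rfl⟩ ⟨_, ⟨e, he, rfl⟩, hde⟩
  rw [← ofDigits_seqAppend, ← ofDigits_seqAppend] at hde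
  exact hvw (Subtype.ext (hW v v.2 w w.2 d hd e he
    (injOn_ofDigits (hfreq w e he) (hfreq v d hd) hde).symm))

theorem isSelfSimilar_and_dimH_eq_of_isOmegaCode [Fintype W] (hW : IsOmegaCode W)
    (h0 : ∀ w ∈ W, ∃ a ∈ w, (a : ℕ) ≠ 0) {α : ℝ≥0} (hα : 0 < α)
    (hsum : ∑ w : W, ((s : ℝ≥0)⁻¹ ^ w.1.length) ^ (α : ℝ) = 1) :
    IsSelfSimilar (Real.ofDigits '' concatenations W) ∧
      dimH (Real.ofDigits '' concatenations W) = α := by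
  have hne : ∀ w ∈ W, w ≠ [] := fun w hw =>
    let ⟨_, ha, _⟩ := h0 w hw
    List.ne_nil_of_mem ha
  have hs : ∀ _ : W, 1 < (s : ℝ≥0) := fun w =>
    let ⟨a, _, ha⟩ := h0 w w.2
    Nat.one_lt_cast.2 (lt_of_le_of_lt (Nat.one_le_iff_ne_zero.2 ha) a.2)
  have hr₀ : ∀ w : W, 0 < (s : ℝ≥0)⁻¹ ^ w.1.length := fun w =>
    pow_pos (inv_pos.2 (one_pos.trans (hs w))) _
  have hr : ∀ w : W, (s : ℝ≥0)⁻¹ ^ w.1.length < 1 := fun w =>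
    pow_lt_one₀ zero_le (inv_lt_one_of_one_lt₀ (hs w)) (List.length_pos_iff.2 (hne w w.2)).ne'
  have := nontrivial_of_sum_rpow_eq_one hr hα hsum
  obtain ⟨w⟩ : Nonempty W := inferInstance
  have hf := fun v : W => edist_digitMap v.1
  have hKc := isCompact_image_ofDigits_concatenations W.toFinite
  have hKn := (concatenations_nonempty w.2 (hne w w.2)).image Real.ofDigits
  have hK := image_ofDigits_concatenations_eq_iUnion fun h => hne [] h rfl
  have hdisj := pairwise_disjoint_digitMap_image hW h0
  exact ⟨isSelfSimilar_of_pairwise_disjoint hf hr₀ hr hKc hKn hK hdisj hα hsum,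
    dimH_eq_of_pairwise_disjoint hf hr hKc hKn hK hdisj hα hsum⟩

end DigitExpansion

section AdmissibleBlocks

theorem replicate_succ_seqAppend {A : Type*} (n : ℕ) (a : A) (d : ℕ → A) :
    seqAppend (List.replicate (n + 1) a) d = seqCons a (seqAppend (List.replicate n a) d) :=
  rfl

theorem replicate_seqAppend_seqCons_inj {A : Type*} {a b c : A} {d e : ℕ → A} (hb : b ≠ a)
    (hc : c ≠ a) {m n : ℕ} :
    seqAppend (List.replicate m a) (seqCons b d) = seqAppend (List.replicate n a) (seqCons c e) ↔
      m = n ∧ b = c ∧ d = e := by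
  induction m generalizing n with
  | zero =>
    cases n with
    | zero => simp [nil_seqAppend, seqCons_inj]
    | succ n => simp [nil_seqAppend, replicate_succ_seqAppend, seqCons_inj, hb]
  | succ m ih =>
    cases n with
    | zero => simp [nil_seqAppend, replicate_succ_seqAppend, seqCons_inj, hc.symm]
    | succ n => simp [replicate_succ_seqAppend, seqCons_inj, ih]

variable {s : ℕ} {a b c u v : Fin s} {d e : ℕ → Fin s}

theorem length_digitBlock (u : Fin s) (hc : (c : ℕ) ≠ 0) : (digitBlock u c).length = c := by
  rw [digitBlock, List.length_append, List.length_replicate, List.length_singleton,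
    Nat.sub_add_cancel (Nat.one_le_iff_ne_zero.2 hc)]

theorem digitBlock_seqAppend {n : ℕ} (u : Fin s) (hc : (c : ℕ) = n + 1) (d : ℕ → Fin s) :
    seqAppend (digitBlock u c) d = seqAppend (List.replicate n u) (seqCons c d) := by
  rw [digitBlock, hc, Nat.add_sub_cancel, append_seqAppend, cons_seqAppend, nil_seqAppend]

theorem exists_eq_replicate_seqAppend (hd : d ∈ concatenations (admissibleBlocks s)) :
    ∃ (u c : Fin s) (n : ℕ), (c : ℕ) = n + 1 ∧ c ≠ u ∧
      ∃ e ∈ concatenations (admissibleBlocks s),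
        d = seqAppend (List.replicate n u) (seqCons c e) := by
  obtain ⟨_, ⟨u, c, hc, hcu, rfl⟩, -, e, he, rfl⟩ := exists_eq_seqAppend_of_mem_concatenations hd
  obtain ⟨n, hn⟩ := Nat.exists_eq_succ_of_ne_zero hc
  exact ⟨u, c, n, hn, hcu, e, he, digitBlock_seqAppend u hn e⟩

theorem mem_or_mem_of_replicate_succ_seqAppend_mem {n : ℕ} (hb : b ≠ a)
    (h : seqAppend (List.replicate (n + 1) a) (seqCons b e) ∈ concatenations (admissibleBlocks s)) :
    ((a : ℕ) = 1 ∧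
        seqAppend (List.replicate n a) (seqCons b e) ∈ concatenations (admissibleBlocks s)) ∨
      ((b : ℕ) = n + 2 ∧ e ∈ concatenations (admissibleBlocks s)) := by
  obtain ⟨u, c, m, hc, hcu, e', he', heq⟩ := exists_eq_replicate_seqAppend h
  cases m with
  | zero =>
    obtain ⟨rfl, rfl⟩ := seqCons_inj.1 heq
    exact Or.inl ⟨hc, he'⟩
  | succ m =>
    obtain rfl : a = u := (seqCons_inj.1 heq).1
    obtain ⟨hnm, rfl, rfl⟩ := (replicate_seqAppend_seqCons_inj hb hcu).1 heq
    exact Or.inr ⟨by lia, he'⟩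

theorem seqCons_mem_of_replicate_seqAppend_mem {n : ℕ} (hb : b ≠ a) (hn : n + 1 < b)
    (h : seqAppend (List.replicate n a) (seqCons b e) ∈ concatenations (admissibleBlocks s)) :
    seqCons b e ∈ concatenations (admissibleBlocks s) := by
  induction n with
  | zero => exact h
  | succ n ih =>
    obtain ⟨-, h'⟩ | ⟨hbn, -⟩ := mem_or_mem_of_replicate_succ_seqAppend_mem hb h
    · exact ih (by lia) h'
    · lia

theorem exists_eq_seqCons_of_seqCons_mem (ha : 2 ≤ (a : ℕ))
    (hae : seqCons a e ∈ concatenations (admissibleBlocks s))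
    (he : e ∈ concatenations (admissibleBlocks s)) :
    ∃ b : Fin s, (b : ℕ) = 2 ∧ b ≠ a ∧
      ∃ d ∈ concatenations (admissibleBlocks s), e = seqCons b d := by
  obtain ⟨u, b, n, hb, hbu, d, hd, heq⟩ := exists_eq_replicate_seqAppend hae
  cases n with
  | zero =>
    obtain ⟨rfl, -⟩ := seqCons_inj.1 heq
    lia
  | succ n =>
    obtain ⟨rfl, rfl⟩ := seqCons_inj.1 heq
    cases n with
    | zero => exact ⟨b, hb, hbu, d, hd, rfl⟩
    | succ n =>
      obtain ⟨ha1, -⟩ | ⟨hbn, -⟩ := mem_or_mem_of_replicate_succ_seqAppend_mem hbu he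
      · lia
      · lia

theorem notMem_concatenations_of_seqCons_mem (ha : 2 ≤ (a : ℕ))
    (hae : seqCons a e ∈ concatenations (admissibleBlocks s)) :
    e ∉ concatenations (admissibleBlocks s) := by
  intro he
  obtain ⟨b, hb, -, d, hd, rfl⟩ := exists_eq_seqCons_of_seqCons_mem ha hae he
  obtain ⟨c, hc, hcb, -⟩ := exists_eq_seqCons_of_seqCons_mem hb.ge he hd
  exact hcb (Fin.ext (hc.trans hb.symm))

theorem le_of_digitBlock_seqAppend_eq (hc : (c : ℕ) ≠ 0) (hcu : c ≠ u) (hb : (b : ℕ) ≠ 0)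
    (hbv : b ≠ v) (hd : d ∈ concatenations (admissibleBlocks s))
    (he : e ∈ concatenations (admissibleBlocks s))
    (h : seqAppend (digitBlock u c) d = seqAppend (digitBlock v b) e) : b ≤ c := by
  by_contra! hlt
  obtain ⟨m, hm⟩ := Nat.exists_eq_succ_of_ne_zero hc
  obtain ⟨n, hn⟩ := Nat.exists_eq_succ_of_ne_zero hb
  have hmn : m < n := by lia
  rw [digitBlock_seqAppend u hm, digitBlock_seqAppend v hn] at h
  obtain ⟨n, rfl⟩ := Nat.exists_eq_succ_of_ne_zero (Nat.ne_zero_of_lt hmn)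
  cases m with
  | zero =>
    obtain ⟨rfl, rfl⟩ := seqCons_inj.1 h
    exact notMem_concatenations_of_seqCons_mem (by lia)
      (seqCons_mem_of_replicate_seqAppend_mem hbv (by lia) hd) he
  | succ m =>
    obtain rfl : u = v := (seqCons_inj.1 h).1
    exact hmn.ne ((replicate_seqAppend_seqCons_inj hcu hbv).1 h).1

theorem isOmegaCode_admissibleBlocks (s : ℕ) : IsOmegaCode (admissibleBlocks s) := by
  rintro _ ⟨u, c, hc, hcu, rfl⟩ _ ⟨v, b, hb, hbv, rfl⟩ d hd e he h
  have hcb : c = b := le_antisymm (le_of_digitBlock_seqAppend_eq hb hbv hc hcu he hd h.symm)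
    (le_of_digitBlock_seqAppend_eq hc hcu hb hbv hd he h)
  exact eq_of_seqAppend_eq h (by rw [length_digitBlock u hc, length_digitBlock v hb, hcb])

theorem exists_mem_ne_zero_of_mem_admissibleBlocks :
    ∀ w ∈ admissibleBlocks s, ∃ a ∈ w, (a : ℕ) ≠ 0 := by
  rintro _ ⟨u, c, hc, -, rfl⟩
  exact ⟨c, List.mem_append_right _ (List.mem_singleton_self c), hc⟩

theorem finite_admissibleBlocks (s : ℕ) : (admissibleBlocks s).Finite := by
  refine (Set.finite_range fun p : Fin s × Fin s => digitBlock p.1 p.2).subset ?_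
  rintro _ ⟨u, c, -, -, rfl⟩
  exact ⟨(u, c), rfl⟩

theorem tildeS_eq_image_ofDigits (s : ℕ) :
    tildeS s = Real.ofDigits '' concatenations (admissibleBlocks s) :=
  Set.ext fun _ => exists_congr fun _ => and_congr_right fun _ => eq_comm

theorem sep_admissibleBlocks_length_eq (hc : (c : ℕ) ≠ 0) :
    {w ∈ admissibleBlocks s | w.length = c} = (digitBlock · c) '' {c}ᶜ := by
  ext w
  constructor
  · rintro ⟨⟨u, b, hb, hbu, rfl⟩, hlen⟩
    obtain rfl : b = c := Fin.ext ((length_digitBlock u hb).symm.trans hlen)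
    exact ⟨u, hbu.symm, rfl⟩
  · rintro ⟨u, hu, rfl⟩
    exact ⟨⟨u, c, hc, Ne.symm hu, rfl⟩, length_digitBlock u hc⟩

theorem digitBlock_of_eq_one (u : Fin s) (hc : (c : ℕ) = 1) : digitBlock u c = [c] := by
  rw [digitBlock, hc, Nat.sub_self, List.replicate_zero, List.nil_append]

theorem digitBlock_left_injective (hc : 2 ≤ (c : ℕ)) : Injective (digitBlock · c) :=
  fun _ _ h => List.replicate_right_injective (by lia) (List.append_cancel_right h)

theorem ncard_admissibleBlocks_length_eq_one (hs : 2 ≤ s) :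
    {w ∈ admissibleBlocks s | w.length = 1}.ncard = 1 := by
  let c : Fin s := ⟨1, hs⟩
  have hne : ({c}ᶜ : Set (Fin s)).Nonempty := ⟨⟨0, by lia⟩, by simp [c]⟩
  have himage : (digitBlock · c) '' {c}ᶜ = {[c]} := by
    simpa only [digitBlock_of_eq_one _ (rfl : (c : ℕ) = 1)] using hne.image_const [c]
  rw [show 1 = (c : ℕ) from rfl, sep_admissibleBlocks_length_eq one_ne_zero, himage,
    Set.ncard_singleton]

theorem ncard_admissibleBlocks_length_eq {k : ℕ} (hk : 2 ≤ k) (hks : k < s) :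
    {w ∈ admissibleBlocks s | w.length = k}.ncard = s - 1 := by
  let c : Fin s := ⟨k, hks⟩
  rw [show k = (c : ℕ) from rfl, sep_admissibleBlocks_length_eq (show k ≠ 0 by lia),
    Set.ncard_image_of_injective _ (digitBlock_left_injective hk), Set.ncard_compl,
    Set.ncard_singleton, Nat.card_fin]

theorem sum_length_eq_sum_ncard {A R : Type*} [Semiring R] {W : Set (List A)} [Fintype W]
    {t : Finset ℕ} (ht : ∀ w ∈ W, w.length ∈ t) (g : ℕ → R) :
    ∑ w : W, g w.1.length = ∑ k ∈ t, ({w ∈ W | w.length = k}.ncard : R) * g k := by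
  classical
  rw [← Finset.sum_fiberwise_of_maps_to (g := fun w : W => w.1.length) fun w _ => ht w w.2]
  refine Finset.sum_congr rfl fun k _ => ?_
  have hcard : {w ∈ W | w.length = k}.ncard =
      (Finset.univ.filter fun w : W => w.1.length = k).card := by
    rw [← Set.ncard_coe_finset, ← Set.ncard_image_of_injective _ Subtype.val_injective]
    congr 1
    ext w
    simp [and_comm]
  rw [hcard, ← nsmul_eq_mul]
  exact Finset.sum_eq_card_nsmul fun w hw => congrArg g (Finset.mem_filter.1 hw).2

theorem sum_admissibleBlocks_length {R : Type*} [Semiring R] [Fintype (admissibleBlocks s)]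
    (hs : 2 ≤ s) (g : ℕ → R) :
    ∑ w : admissibleBlocks s, g w.1.length =
      g 1 + ∑ k ∈ Finset.Icc 2 (s - 1), ((s - 1 : ℕ) : R) * g k := by
  have hlen : ∀ w ∈ admissibleBlocks s, w.length ∈ Finset.Icc 1 (s - 1) := by
    rintro _ ⟨u, c, hc, -, rfl⟩
    rw [length_digitBlock u hc, Finset.mem_Icc]
    lia
  rw [sum_length_eq_sum_ncard hlen, ← Finset.insert_Icc_add_one_left_eq_Icc (by lia),
    Finset.sum_insert (by simp), ncard_admissibleBlocks_length_eq_one hs, Nat.cast_one, one_mul]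
  refine congrArg (g 1 + ·) (Finset.sum_congr rfl fun k hk => ?_)
  rw [Finset.mem_Icc] at hk
  rw [ncard_admissibleBlocks_length_eq hk.1 (by lia)]

end AdmissibleBlocks

section DimensionEquation

theorem sum_Icc_two_mul_inv_pow {K : Type*} [Field K] {x : K} (hx : x ≠ 0) (n : ℕ) :
    ∑ k ∈ Finset.Icc 2 (n + 1), (x - 1) * x⁻¹ ^ k = x⁻¹ - x⁻¹ ^ (n + 1) := by
  induction n with
  | zero => simp
  | succ n ih =>
    rw [Finset.sum_Icc_succ_top (by lia), ih]
    linear_combination x⁻¹ ^ (n + 1) * mul_inv_cancel₀ hx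

theorem exists_dimension_equation {s : ℕ} (hs : 2 < s) :
    ∃ α : ℝ≥0, 0 < α ∧ α < 1 ∧
      (1 / (s : ℝ)) ^ (α : ℝ) + ∑ k ∈ Finset.Icc 2 (s - 1),
        ((s : ℝ) - 1) * (1 / (s : ℝ)) ^ ((k : ℝ) * (α : ℝ)) = 1 := by
  have hs3 : (3 : ℝ) ≤ s := by exact_mod_cast hs
  have hs0 : 1 / (s : ℝ) ≠ 0 := one_div_ne_zero (by linarith)
  let F : ℝ → ℝ := fun α => (1 / (s : ℝ)) ^ α +
    ∑ k ∈ Finset.Icc 2 (s - 1), ((s : ℝ) - 1) * (1 / (s : ℝ)) ^ ((k : ℝ) * α)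
  have hF : Continuous F := by
    have := Real.continuous_const_rpow hs0
    fun_prop
  have hF0 : 1 < F 0 := by
    have : 0 < ∑ k ∈ Finset.Icc 2 (s - 1), ((s : ℝ) - 1) :=
      Finset.sum_pos (fun k _ => by linarith) ⟨2, Finset.mem_Icc.2 ⟨le_rfl, by lia⟩⟩
    simpa only [F, mul_zero, Real.rpow_zero, mul_one, lt_add_iff_pos_right] using this
  have hF1 : F 1 < 1 := by
    obtain ⟨n, hn⟩ : ∃ n, s - 1 = n + 1 := ⟨s - 2, by lia⟩
    have hpow : 0 < (s : ℝ)⁻¹ ^ (n + 1) := by positivity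
    have hinv : (s : ℝ)⁻¹ ≤ 3⁻¹ := inv_anti₀ (by norm_num) hs3
    simp only [F, mul_one, Real.rpow_one, Real.rpow_natCast, one_div, hn,
      sum_Icc_two_mul_inv_pow (show (s : ℝ) ≠ 0 by linarith)]
    linarith
  obtain ⟨α, ⟨hα0, hα1⟩, hα⟩ :=
    intermediate_value_Ioo' zero_le_one hF.continuousOn (show (1 : ℝ) ∈ _ from ⟨hF1, hF0⟩)
  exact ⟨⟨α, hα0.le⟩, hα0, hα1, hα⟩

theorem sum_admissibleBlocks_rpow_eq {s : ℕ} [Fintype (admissibleBlocks s)] (hs : 2 ≤ s)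
    (α : ℝ) :
    ((∑ w : admissibleBlocks s, ((s : ℝ≥0)⁻¹ ^ w.1.length) ^ α : ℝ≥0) : ℝ) =
      (1 / (s : ℝ)) ^ α +
        ∑ k ∈ Finset.Icc 2 (s - 1), ((s : ℝ) - 1) * (1 / (s : ℝ)) ^ ((k : ℝ) * α) := by
  rw [sum_admissibleBlocks_length hs fun k => ((s : ℝ≥0)⁻¹ ^ k) ^ α]
  simp only [NNReal.coe_add, NNReal.coe_sum, NNReal.coe_mul, NNReal.coe_rpow, NNReal.coe_pow,
    NNReal.coe_inv, NNReal.coe_natCast, Nat.cast_pred (show 0 < s by lia), one_div, pow_one,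
    Real.rpow_mul (inv_nonneg.2 (Nat.cast_nonneg s)), Real.rpow_natCast]

end DimensionEquation

section Fractal

variable {K : Set ℝ}

theorem isFractalNarrow_of_dimH_eq {α : ℝ≥0} (h : dimH K = α) (h0 : 0 < α) (h1 : α < 1) :
    IsFractalNarrow K := by
  refine ⟨h ▸ ENNReal.coe_ne_top, fun n hn => ?_⟩
  obtain rfl : α = n := by exact_mod_cast h.symm.trans hn
  exact (Nat.cast_pos.1 h0).ne' (Nat.cast_lt_one.1 h1)

theorem IsFractalNarrow.isFractalWide (h : IsFractalNarrow K) : IsFractalWide K := by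
  intro he
  induction hd : smallInductiveDimension K using WithBot.recBotCoe with
  | bot => rw [hd] at he; exact absurd he (by simp)
  | coe d =>
    rw [hd, WithBot.map_coe, WithBot.coe_inj] at he
    induction d using ENat.recTopCoe with
    | top => exact h.1 (by simpa using he.symm)
    | coe n => exact h.2 n (by simpa using he.symm)

end Fractal

theorem theorem5 (s : ℕ) (hs : 2 < s) :
    IsSelfSimilar (tildeS s) ∧ IsFractalWide (tildeS s) ∧ IsFractalNarrow (tildeS s) ∧
      ∃ α₀ : ℝ≥0, dimH (tildeS s) = (α₀ : ℝ≥0∞) ∧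
        (1 / (s : ℝ)) ^ (α₀ : ℝ) +
          ∑ k ∈ Finset.Icc 2 (s - 1), ((s : ℝ) - 1) * (1 / (s : ℝ)) ^ ((k : ℝ) * (α₀ : ℝ)) = 1 := by
  have := (finite_admissibleBlocks s).fintype
  obtain ⟨α, hα0, hα1, hα⟩ := exists_dimension_equation hs
  have hsum : ∑ w : admissibleBlocks s, ((s : ℝ≥0)⁻¹ ^ w.1.length) ^ (α : ℝ) = 1 :=
    NNReal.coe_injective ((sum_admissibleBlocks_rpow_eq hs.le α).trans hα)
  obtain ⟨hself, hdim⟩ := isSelfSimilar_and_dimH_eq_of_isOmegaCode (isOmegaCode_admissibleBlocks s)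
    exists_mem_ne_zero_of_mem_admissibleBlocks hα0 hsum
  rw [← tildeS_eq_image_ofDigits] at hself hdim
  have hnarrow := isFractalNarrow_of_dimH_eq hdim hα0 hα1
  exact ⟨hself, hnarrow.isFractalWide, hnarrow, α, hdim, hα⟩
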